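/- Let $n\in\mathbb{N}$, $b\in\mathbb{R}^n\setminus\mathbb{Z}^n$, let $Q\subseteq\mathbb{R}^n$ be a rational polyhedron, and let $S=(b+\mathbb{Z}^n)\cap Q$. A closed convex set $K\subseteq\mathbb{R}^n$ is $S$-free if $\operatorname{int}(K)\cap S=\emptyset$, and a maximal $S$-free set is an $S$-free closed convex set that is not properly contained in any other such set. Let $K$ be a polyhedron that is a maximal $S$-free set with $0\in\operatorname{int}(K)$, and let $a_i r\le 1$, $i\in I$ ($I$ finite), be an irredundant description of $K$. Put $$L_K=\{r\in\mathbb{R}^n: a_i r=a_j r\ \text{for all } i,j\in I\},$$ and, for $s\in\mathbb{R}^n$ and $k\in I$, $$T_k(s)=\{r\in\mathbb{R}^n:(a_i-a_k)r\le 0,\ (a_i-a_k)(s-r)\le 0\ \text{ for all } i\in I\}.$$ Then for each $s\in K\cap S$ there is an index $k\in I$ with $a_k s=1$. Choose, for each $s\in K\cap S$, any index $k(s)\in I$ with $a_{k(s)}s=1$, and define the spindle $T(s)=T_{k(s)}(s)$ and the lifting region $T(S,K)=\bigcup_{s\in K\cap S}T(s)$. For every such choice the following hold. (i) $\operatorname{lin}(T(s))=\operatorname{rec}(T(s))=L_K$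 for every $s\in K\cap S$, where $\operatorname{rec}$ is the recession cone and $\operatorname{lin}$ the lineality space. (ii) $T(s)=T(s')$ for all $s,s'\in K\cap S$ with $s-s'\in L_K$. More generally, for all $s,s'\in\mathbb{R}^n$ with $s-s'\in L_K$, one has $T_k(s)=T_k(s')$ for every $k\in I$, and $T_k(s)=T_{k'}(s')$ whenever $a_k s=\max_{i\in I}a_i s$ and $a_{k'}s'=\max_{i\in I}a_i s'$. (iii) $T(S,K)$ is a union of finitely many polyhedra. -/

import Mathlib

open Set
open scoped Matrix

/-- The integer points `ℤⁿ` of `ℝⁿ`. -/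
def integerPoints (n : ℕ) : Set (Fin n → ℝ) :=
  {x | ∃ z : Fin n → ℤ, ∀ j, x j = (z j : ℝ)}

/-- The translated lattice `b + ℤⁿ`. -/
def translatedLattice {n : ℕ} (b : Fin n → ℝ) : Set (Fin n → ℝ) :=
  {x | ∃ z ∈ integerPoints n, x = b + z}

/-- A polyhedron: the solution set of finitely many linear inequalities. -/
def IsPolyhedron {n : ℕ} (P : Set (Fin n → ℝ)) : Prop :=
  ∃ (m : ℕ) (A : Matrix (Fin m) (Fin n) ℝ) (β : Fin m → ℝ),
    P = {x | ∀ i, A i ⬝ᵥ x ≤ β i}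

/-- A rational polyhedron: all the coefficients and right-hand sides can be taken rational. -/
def IsRationalPolyhedron {n : ℕ} (P : Set (Fin n → ℝ)) : Prop :=
  ∃ (m : ℕ) (A : Matrix (Fin m) (Fin n) ℚ) (β : Fin m → ℚ),
    P = {x | ∀ i, (fun j => (A i j : ℝ)) ⬝ᵥ x ≤ (β i : ℝ)}

/-- A closed convex set is `S`-free if its interior contains no point of `S`. -/
structure IsSFree {n : ℕ} (S K : Set (Fin n → ℝ)) : Prop where
  isClosed : IsClosed K
  convex : Convex ℝ K
  interior_inter : interior K ∩ S = ∅

/-- An `S`-free convex set that is not properly contained in any `S`-free convex set. -/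
def IsMaximalSFree {n : ℕ} (S K : Set (Fin n → ℝ)) : Prop :=
  IsSFree S K ∧ ∀ K' : Set (Fin n → ℝ), IsSFree S K' → ¬ K ⊂ K'

/-- `a i · x ≤ 1`, `i ∈ I`, is an irredundant description of `K`: it describes `K`, and leaving
out any one of the inequalities changes the solution set. -/
structure IsIrredundantDescription {n : ℕ} {I : Type*} (a : I → Fin n → ℝ)
    (K : Set (Fin n → ℝ)) : Prop where
  eq_setOf : K = {x | ∀ i, a i ⬝ᵥ x ≤ 1}
  irredundant : ∀ j, {x | ∀ i, i ≠ j → a i ⬝ᵥ x ≤ 1} ≠ K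

/-- The recession cone of a (nonempty, closed, convex) set. -/
def recessionCone {n : ℕ} (C : Set (Fin n → ℝ)) : Set (Fin n → ℝ) :=
  {r | ∀ x ∈ C, ∀ t : ℝ, 0 ≤ t → x + t • r ∈ C}

/-- The lineality space: the directions `r` such that `r` and `-r` are recession directions. -/
def linealitySpace {n : ℕ} (C : Set (Fin n → ℝ)) : Set (Fin n → ℝ) :=
  {r | r ∈ recessionCone C ∧ -r ∈ recessionCone C}

/-- `L_K = {r | a i · r = a j · r for all i, j}`. -/
def equalitySpace {n : ℕ} {I : Type*} (a : I → Fin n → ℝ) : Set (Fin n → ℝ) :=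
  {r | ∀ i j, a i ⬝ᵥ r = a j ⬝ᵥ r}

/-- The spindle `T(s)`, formed with the index `k = k(s)`. -/
def spindle {n : ℕ} {I : Type*} (a : I → Fin n → ℝ) (k : I) (s : Fin n → ℝ) :
    Set (Fin n → ℝ) :=
  {r | ∀ i, (a i - a k) ⬝ᵥ r ≤ 0 ∧ (a i - a k) ⬝ᵥ (s - r) ≤ 0}

/-- The lifting region `T(S,K)`: the union of the spindles `T(s)` over `s ∈ K ∩ S`, for a choice
`k` of an index for each such `s`. -/
def liftingRegion {n : ℕ} {I : Type*} (a : I → Fin n → ℝ) (S K : Set (Fin n → ℝ))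
    (k : ↥(K ∩ S) → I) : Set (Fin n → ℝ) :=
  ⋃ s : ↥(K ∩ S), spindle a (k s) (s : Fin n → ℝ)

/-!
The recession cone of a spindle, and its invariance along `equalitySpace a`, are read off from its
inequalities. The substance is that the lifting region is a finite union. Since `spindle a k s`
depends only on `k` and on the vector of values `(a i ⬝ᵥ s)`, it suffices that these vectors are
finite in number for `s ∈ K ∩ S` (`finite_image_dotProduct`).

Suppose they are not, and let `Q` be given by the rational inequalities `A j ⬝ᵥ x ≤ β j`. All the
coordinates `a i ⬝ᵥ s` and `A j ⬝ᵥ s` are bounded above on `K ∩ S`, so there is a sequence `σ` in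
`K ∩ S` with distinct vectors of values along which each of them converges or tends to `-∞`. By
discreteness, the convergent coordinates `A j ⬝ᵥ σ k` are eventually constant. Let `C` be the set of
indices `i` for which `a i ⬝ᵥ σ k` converges. If `C` omits an index, put `y = 0`; otherwise, let
`y ≠ 0` be a limit of the normalized differences of consecutive vectors of values. The set of the
points `x` with `a i ⬝ᵥ x + t * y i < 1` for all `i ∈ C` and some real `t` is open, convex, contains
the interior of `K`, and also contains a facet point of `K`. As `K` is maximal, this set has a point
`s` in `S` (`IsMaximalSFree.exists_mem_relaxation`). Now `s` is shifted by an integer multiple of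
a late difference of consecutive terms of `σ`, which changes the values by about `t * y i`
(`exists_direction_of_tendsto`), and then by a difference `σ k - σ N` with `k` much larger than `N`,
which hardly affects the convergent coordinates and makes the others very negative. The result is
a point of `S` in the interior of `K` (`false_of_sequence`), a contradiction.
-/

open Filter Topology

/-! ### Polyhedra given by inequalities `a i ⬝ᵥ x ≤ 1` -/

theorem continuous_dotProduct_left {n : ℕ} (v : Fin n → ℝ) :
    Continuous fun x : Fin n → ℝ => v ⬝ᵥ x := by
  unfold dotProduct
  fun_prop

theorem interior_setOf_forall_dotProduct_le_one {n : ℕ} {I : Type*} [Finite I]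
    (a : I → Fin n → ℝ) :
    interior {x | ∀ i, a i ⬝ᵥ x ≤ 1} = {x | ∀ i, a i ⬝ᵥ x < 1} := by
  apply Subset.antisymm
  · intro x hx i
    -- a point of the interior stays in the set when it is stretched slightly
    have hc : Tendsto (fun c : ℝ => c • x) (𝓝[>] 1) (𝓝 x) := by
      have : Continuous fun c : ℝ => c • x := by fun_prop
      have h := this.tendsto 1
      rw [one_smul] at h
      exact h.mono_left nhdsWithin_le_nhds
    obtain ⟨c, hcx, hc1⟩ :=
      ((hc.eventually (mem_interior_iff_mem_nhds.1 hx)).and self_mem_nhdsWithin).exists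
    have h1 : a i ⬝ᵥ (c • x) ≤ 1 := hcx i
    rw [dotProduct_smul, smul_eq_mul] at h1
    have hc1 : 1 < c := hc1
    by_contra! h
    nlinarith
  · apply interior_maximal
    · exact fun x hx i => (hx i).le
    · simp only [ofPred_forall]
      exact isOpen_iInter_of_finite fun i =>
        isOpen_lt (continuous_dotProduct_left _) continuous_const

/-- Every inequality of an irredundant description defines a facet, and this facet has a point at
which all the other inequalities are strict. -/
theorem IsIrredundantDescription.exists_facet_point {n : ℕ} {I : Type*} {a : I → Fin n → ℝ}
    {K : Set (Fin n → ℝ)} (h : IsIrredundantDescription a K) (j : I) :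
    ∃ x, a j ⬝ᵥ x = 1 ∧ ∀ i, i ≠ j → a i ⬝ᵥ x < 1 := by
  obtain ⟨x, hx, hxj⟩ : ∃ x, (∀ i, i ≠ j → a i ⬝ᵥ x ≤ 1) ∧ 1 < a j ⬝ᵥ x := by
    by_contra! hcon
    refine h.irredundant j ?_
    rw [h.eq_setOf]
    ext x
    refine ⟨fun hx i => ?_, fun hx i _ => hx i⟩
    by_cases hij : i = j
    · exact hij ▸ hcon x hx
    · exact hx i hij
  -- the segment from the interior point `0` to `x` crosses the facet
  have hpos : 0 < a j ⬝ᵥ x := by linarith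
  refine ⟨(a j ⬝ᵥ x)⁻¹ • x, ?_, fun i hij => ?_⟩
  · rw [dotProduct_smul, smul_eq_mul, inv_mul_cancel₀ hpos.ne']
  · rw [dotProduct_smul, smul_eq_mul, inv_mul_lt_iff₀ hpos]
    linarith [hx i hij]

/-- The relaxation of `a i ⬝ᵥ x ≤ 1`, `i ∈ I`, that keeps the inequalities of `C` only and lets
their right-hand sides slide along the line `ℝ y`, contains a point of `S` in its interior as soon
as it is a proper relaxation. -/
theorem IsMaximalSFree.exists_mem_relaxation {n : ℕ} {S K : Set (Fin n → ℝ)} {I : Type*} [Finite I]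
    {a : I → Fin n → ℝ} (hK : IsMaximalSFree S K) (hKa : IsIrredundantDescription a K)
    (C : Set I) (y : I → ℝ) (hCy : ∃ i, i ∉ C ∨ y i ≠ 0) :
    ∃ s ∈ S, ∃ t : ℝ, ∀ i ∈ C, a i ⬝ᵥ s + t * y i < 1 := by
  by_contra! hcon
  set U : Set (Fin n → ℝ) := {x | ∃ t : ℝ, ∀ i ∈ C, a i ⬝ᵥ x + t * y i < 1} with hU
  have hUo : IsOpen U := by
    have : U = ⋃ t : ℝ, ⋂ i ∈ C, {x | a i ⬝ᵥ x + t * y i < 1} := by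
      ext x; simp [hU]
    rw [this]
    refine isOpen_iUnion fun t => (Set.toFinite C).isOpen_biInter fun i _ => ?_
    exact isOpen_lt ((continuous_dotProduct_left _).add continuous_const) continuous_const
  have hUc : Convex ℝ U := by
    rintro x ⟨t, ht⟩ x' ⟨t', ht'⟩ p q hp hq hpq
    refine ⟨p * t + q * t', fun i hi => ?_⟩
    have h1 := ht i hi
    have h2 := ht' i hi
    rw [dotProduct_add, dotProduct_smul, dotProduct_smul, smul_eq_mul, smul_eq_mul]
    have h3 : p * (a i ⬝ᵥ x + t * y i) + q * (a i ⬝ᵥ x' + t' * y i) < 1 := by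
      rcases hp.eq_or_lt with rfl | hp'
      · have : q = 1 := by linarith
        subst this; linarith
      · nlinarith [mul_lt_mul_of_pos_left h1 hp', mul_le_mul_of_nonneg_left h2.le hq]
    linarith
  have hintK : interior K = {x | ∀ i, a i ⬝ᵥ x < 1} := by
    rw [hKa.eq_setOf, interior_setOf_forall_dotProduct_le_one]
  have hsub : interior K ⊆ U := by
    rw [hintK]
    exact fun x hx => ⟨0, fun i _ => by simpa using hx i⟩
  have h0 : (0 : Fin n → ℝ) ∈ interior K := by simp [hintK]
  have hint : interior (closure U) = U := by
    rw [hUc.interior_closure_eq_interior_of_nonempty_interior, hUo.interior_eq]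
    exact ⟨0, by rw [hUo.interior_eq]; exact hsub h0⟩
  have hfree : IsSFree S (closure U) := by
    refine ⟨isClosed_closure, hUc.closure, ?_⟩
    rw [hint, eq_empty_iff_forall_notMem]
    rintro s ⟨⟨t, ht⟩, hs⟩
    obtain ⟨i, hi, h⟩ := hcon s hs t
    exact (ht i hi).not_ge h
  have hKU : K ⊆ closure U := by
    refine subset_closure.trans ?_
    rw [← hK.1.convex.closure_interior_eq_closure_of_nonempty_interior ⟨0, h0⟩]
    exact closure_mono hsub
  have hUK : U ⊆ interior K := by
    refine interior_maximal (subset_closure.trans ?_) hUo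
    by_contra h
    exact hK.2 _ hfree ⟨hKU, h⟩
  -- a facet point of an inequality that is relaxed lies in `U`
  obtain ⟨j, hj⟩ := hCy
  obtain ⟨x, hxj, hx⟩ := hKa.exists_facet_point j
  suffices x ∈ U by
    have h := hUK this
    rw [hintK] at h
    exact (h j).ne hxj
  have hev : ∀ᶠ τ in 𝓝[>] (0 : ℝ), ∀ i, i ≠ j → a i ⬝ᵥ x + -τ * y j * y i < 1 := by
    refine eventually_all.2 fun i => ?_
    by_cases hij : i = j
    · exact Eventually.of_forall fun _ h => absurd hij h
    have hcont : Continuous fun τ : ℝ => a i ⬝ᵥ x + -τ * y j * y i := by fun_prop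
    have hlt : ∀ᶠ τ in 𝓝 (0 : ℝ), a i ⬝ᵥ x + -τ * y j * y i < 1 :=
      hcont.continuousAt.eventually_lt continuousAt_const (by simpa using hx i hij)
    exact (hlt.filter_mono nhdsWithin_le_nhds).mono fun τ h _ => h
  obtain ⟨τ, hτ, hτ0⟩ := (hev.and self_mem_nhdsWithin).exists
  have hτ0 : 0 < τ := hτ0
  refine ⟨-τ * y j, fun i hi => ?_⟩
  by_cases hij : i = j
  · subst hij
    have hy : y i ≠ 0 := hj.resolve_left (not_not.2 hi)
    have : 0 < τ * (y i * y i) := mul_pos hτ0 (mul_self_pos.2 hy)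
    rw [hxj]
    linarith
  · exact hτ i hij

/-! ### Sequences bounded above -/

theorem exists_subseq_tendsto_atBot_or_nhds {ι : Type*} [Finite ι] (f : ℕ → ι → ℝ) (B : ι → ℝ)
    (hB : ∀ m i, f m i ≤ B i) :
    ∃ φ : ℕ → ℕ, StrictMono φ ∧ ∀ i, Tendsto (fun m => f (φ m) i) atTop atBot ∨
      ∃ c, Tendsto (fun m => f (φ m) i) atTop (𝓝 c) := by
  have := Fintype.ofFinite ι
  -- compactness of the power `ι → [-∞, ∞]`
  obtain ⟨L, φ, hφ, hL⟩ :=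
    CompactSpace.tendsto_subseq (fun m i => ((f m i : ℝ) : EReal) : ℕ → ι → EReal)
  refine ⟨φ, hφ, fun i => ?_⟩
  have hi : Tendsto (fun m => ((f (φ m) i : ℝ) : EReal)) atTop (𝓝 (L i)) :=
    (tendsto_pi_nhds.1 hL) i
  have hle : L i ≤ (B i : EReal) :=
    le_of_tendsto' hi fun m => EReal.coe_le_coe_iff.2 (hB _ _)
  induction h : L i with
  | bot => left; rw [h] at hi; exact EReal.tendsto_coe_nhds_bot_iff.1 hi
  | top => rw [h] at hle; exact absurd (top_le_iff.1 hle) (EReal.coe_ne_top _)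
  | coe c => right; rw [h] at hi; exact ⟨c, EReal.tendsto_coe.1 hi⟩

theorem Filter.Tendsto.eventually_forall_ge_abs_sub_lt {u : ℕ → ℝ} {c : ℝ}
    (h : Tendsto u atTop (𝓝 c)) {ε : ℝ} (hε : 0 < ε) :
    ∀ᶠ N in atTop, ∀ l ≥ N, ∀ m ≥ N, |u m - u l| < ε := by
  obtain ⟨N, hN⟩ := Metric.cauchySeq_iff.1 h.cauchySeq ε hε
  filter_upwards [eventually_ge_atTop N] with M hM l hl m hm
  exact hN m (hM.trans hm) l (hM.trans hl)

/-- An injective convergent sequence in a finite power of `ℝ` has a tangent direction `y` at its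
limit: every point of the line `ℝ y` is approximated by integer multiples of a difference of two
consecutive terms of the sequence, taken as far out as desired. -/
theorem exists_direction_of_tendsto {I : Type*} [Finite I] {v : ℕ → I → ℝ}
    (hinj : Function.Injective v) (hconv : ∀ i, ∃ c, Tendsto (fun m => v m i) atTop (𝓝 c)) :
    ∃ y : I → ℝ, (∃ i, y i ≠ 0) ∧ ∀ t ε : ℝ, 0 < ε → ∀ M : ℕ, ∃ l ≥ M, ∃ N : ℤ,
      ∀ i, |N * (v (l + 1) i - v l i) - t * y i| < ε := by
  have := Fintype.ofFinite I
  set d : ℕ → I → ℝ := fun l => v (l + 1) - v l with hd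
  have hd0 : ∀ l, 0 < ‖d l‖ := fun l =>
    norm_pos_iff.2 (sub_ne_zero.2 (hinj.ne (Nat.succ_ne_self l)))
  have hdlim : Tendsto (fun l => ‖d l‖) atTop (𝓝 0) := by
    choose c hc using hconv
    have h1 : Tendsto v atTop (𝓝 c) := tendsto_pi_nhds.2 hc
    have h2 := ((h1.comp (tendsto_add_atTop_nat 1)).sub h1).norm
    simpa using h2
  obtain ⟨y, hy, φ, hφ, hlim⟩ := (isCompact_sphere (0 : I → ℝ) 1).tendsto_subseq
    (x := fun l => ‖d l‖⁻¹ • d l) (fun l => by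
      rw [mem_sphere_zero_iff_norm, norm_smul, norm_inv, norm_norm, inv_mul_cancel₀ (hd0 l).ne'])
  refine ⟨y, ?_, fun t ε hε M => ?_⟩
  · by_contra! h
    have : y = 0 := funext h
    rw [mem_sphere_zero_iff_norm, this, norm_zero] at hy
    exact zero_ne_one hy
  have hsmall : ∀ᶠ m in atTop, |t| * dist ((‖d (φ m)‖⁻¹ • d (φ m))) y < ε / 2 := by
    have h := (tendsto_iff_dist_tendsto_zero.1 hlim).const_mul |t|
    rw [mul_zero] at h
    exact h.eventually_lt_const (by linarith)
  have hsmall' : ∀ᶠ m in atTop, ‖d (φ m)‖ < ε / 2 :=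
    (hdlim.comp hφ.tendsto_atTop).eventually_lt_const (by linarith)
  obtain ⟨m, h1, h2, h3⟩ := (hsmall.and (hsmall'.and (eventually_ge_atTop M))).exists
  refine ⟨φ m, h3.trans hφ.le_apply, ⌊t / ‖d (φ m)‖⌋, fun i => ?_⟩
  set δ := ‖d (φ m)‖ with hδ
  have hδ0 : 0 < δ := hd0 _
  have hdi : |d (φ m) i| ≤ δ := norm_le_pi_norm (d (φ m)) i
  have hyi : |δ⁻¹ * d (φ m) i - y i| ≤ dist (δ⁻¹ • d (φ m)) y := by
    rw [dist_eq_norm]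
    exact norm_le_pi_norm (δ⁻¹ • d (φ m) - y) i
  have hfl : |(⌊t / δ⌋ : ℝ) - t / δ| ≤ 1 := by
    rw [abs_le]
    constructor <;> linarith [Int.floor_le (t / δ), Int.lt_floor_add_one (t / δ)]
  have key : (⌊t / δ⌋ : ℝ) * (v (φ m + 1) i - v (φ m) i) - t * y i =
      ((⌊t / δ⌋ : ℝ) - t / δ) * d (φ m) i + t * (δ⁻¹ * d (φ m) i - y i) := by
    simp only [hd, Pi.sub_apply]
    ring
  rw [key]
  calc _ ≤ |(⌊t / δ⌋ : ℝ) - t / δ| * |d (φ m) i| + |t| * |δ⁻¹ * d (φ m) i - y i| := by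
        rw [← abs_mul, ← abs_mul]; exact abs_add_le _ _
    _ ≤ 1 * δ + |t| * dist (δ⁻¹ • d (φ m)) y := by gcongr
    _ < ε := by linarith

/-! ### Integer points and rational data -/

theorem integerPoints_add {n : ℕ} {x y : Fin n → ℝ} (hx : x ∈ integerPoints n)
    (hy : y ∈ integerPoints n) : x + y ∈ integerPoints n := by
  obtain ⟨z, hz⟩ := hx
  obtain ⟨w, hw⟩ := hy
  exact ⟨z + w, fun j => by simp [hz, hw]⟩

theorem integerPoints_intCast_smul {n : ℕ} {x : Fin n → ℝ} (N : ℤ) (hx : x ∈ integerPoints n) :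
    (N : ℝ) • x ∈ integerPoints n := by
  obtain ⟨z, hz⟩ := hx
  exact ⟨N • z, fun j => by simp [hz]⟩

theorem sub_mem_integerPoints {n : ℕ} {b x y : Fin n → ℝ} (hx : x ∈ translatedLattice b)
    (hy : y ∈ translatedLattice b) : x - y ∈ integerPoints n := by
  obtain ⟨_, ⟨z, hz⟩, rfl⟩ := hx
  obtain ⟨_, ⟨w, hw⟩, rfl⟩ := hy
  exact ⟨z - w, fun j => by simp [hz, hw]⟩

theorem add_mem_translatedLattice {n : ℕ} {b x y : Fin n → ℝ} (hx : x ∈ translatedLattice b)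
    (hy : y ∈ integerPoints n) : x + y ∈ translatedLattice b := by
  obtain ⟨z, hz, rfl⟩ := hx
  exact ⟨z + y, integerPoints_add hz hy, add_assoc _ _ _⟩

/-- A rational linear form takes a discrete set of values on `ℤⁿ`. -/
theorem exists_pos_forall_integerPoints_dotProduct_eq_zero {n : ℕ} (q : Fin n → ℚ) :
    ∃ δ > (0 : ℝ), ∀ x ∈ integerPoints n,
      |(fun j => (q j : ℝ)) ⬝ᵥ x| < δ → (fun j => (q j : ℝ)) ⬝ᵥ x = 0 := by
  -- the product of the denominators makes the form integral
  set D : ℕ := ∏ j, (q j).den with hD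
  have hDpos : (0 : ℝ) < D := by
    exact_mod_cast Finset.prod_pos fun j _ => (q j).den_pos
  refine ⟨(D : ℝ)⁻¹, inv_pos.2 hDpos, ?_⟩
  rintro x ⟨z, hz⟩ hlt
  have hint : ∀ j, ∃ p : ℤ, (D : ℝ) * (q j : ℝ) = p := by
    intro j
    obtain ⟨c, hc⟩ : (q j).den ∣ D := Finset.dvd_prod_of_mem _ (Finset.mem_univ j)
    refine ⟨c * (q j).num, ?_⟩
    have h : ((q j).den : ℝ) * (q j : ℝ) = (q j).num := by
      exact_mod_cast Rat.den_mul_eq_num (q j)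
    rw [hc]
    push_cast
    rw [← h]
    ring
  choose p hp using hint
  have hval : (D : ℝ) * ((fun j => (q j : ℝ)) ⬝ᵥ x) = ((∑ j, p j * z j : ℤ) : ℝ) := by
    simp only [dotProduct, Finset.mul_sum]
    push_cast
    exact Finset.sum_congr rfl fun j _ => by rw [← mul_assoc, hp, hz]
  have habs : |((∑ j, p j * z j : ℤ) : ℝ)| < 1 := by
    rw [← hval, abs_mul, abs_of_pos hDpos]
    calc _ < (D : ℝ) * (D : ℝ)⁻¹ := by gcongr
      _ = 1 := mul_inv_cancel₀ hDpos.ne'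
  have hzero : (∑ j, p j * z j : ℤ) = 0 := by
    rw [← Int.abs_lt_one_iff]
    exact_mod_cast habs
  rw [hzero, Int.cast_zero] at hval
  exact (mul_eq_zero.1 hval).resolve_left hDpos.ne'

theorem eventually_forall_ge_dotProduct_sub_eq_zero {n : ℕ} {b : Fin n → ℝ} (q : Fin n → ℚ)
    {σ : ℕ → Fin n → ℝ} (hσ : ∀ k, σ k ∈ translatedLattice b)
    (h : ∃ c, Tendsto (fun k => (fun l => (q l : ℝ)) ⬝ᵥ σ k) atTop (𝓝 c)) :
    ∀ᶠ N in atTop, ∀ l ≥ N, ∀ k ≥ N, (fun l => (q l : ℝ)) ⬝ᵥ (σ k - σ l) = 0 := by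
  obtain ⟨c, hc⟩ := h
  obtain ⟨δ, hδ, hq⟩ := exists_pos_forall_integerPoints_dotProduct_eq_zero q
  filter_upwards [hc.eventually_forall_ge_abs_sub_lt hδ] with N hN l hl k hk
  refine hq _ (sub_mem_integerPoints (hσ k) (hσ l)) ?_
  rw [dotProduct_sub]
  exact hN l hl k hk

/-! ### Finiteness modulo the equality space -/

/-- The contradiction behind the finiteness: if `S` has no point at which all the forms `a i` are
less than `1`, and `σ` is a sequence in `S` whose coordinates `a i ⬝ᵥ ·` and `A j ⬝ᵥ ·` converge or
tend to `-∞`, then no `s ∈ S` satisfies the convergent inequalities strictly after a shift `t * y`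
that integer vectors `u` approximate. Otherwise `s` could be moved to a forbidden point. The move
is the sum of an integer vector `u`, on which the convergent forms `A j` vanish, and of a
difference of two terms of `σ`; the latter changes the convergent coordinates arbitrarily little
and decreases the others arbitrarily much. -/
theorem false_of_sequence {n m : ℕ} {b : Fin n → ℝ} {A : Fin m → Fin n → ℚ} {β : Fin m → ℚ}
    {I : Type*} [Finite I] {a : I → Fin n → ℝ} {Q S : Set (Fin n → ℝ)}
    (hQ : Q = {x | ∀ j, (fun l => (A j l : ℝ)) ⬝ᵥ x ≤ (β j : ℝ)})
    (hS : S = translatedLattice b ∩ Q)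
    (hint : ∀ s ∈ S, ∃ i, 1 ≤ a i ⬝ᵥ s)
    {σ : ℕ → Fin n → ℝ} (hσ : ∀ k, σ k ∈ S)
    (ha : ∀ i, Tendsto (fun k => a i ⬝ᵥ σ k) atTop atBot ∨
      ∃ c, Tendsto (fun k => a i ⬝ᵥ σ k) atTop (𝓝 c))
    (hA : ∀ j, Tendsto (fun k => (fun l => (A j l : ℝ)) ⬝ᵥ σ k) atTop atBot ∨
      ∃ c, Tendsto (fun k => (fun l => (A j l : ℝ)) ⬝ᵥ σ k) atTop (𝓝 c))
    (y : I → ℝ) {s : Fin n → ℝ} (hs : s ∈ S) (t : ℝ)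
    (hst : ∀ i, (∃ c, Tendsto (fun k => a i ⬝ᵥ σ k) atTop (𝓝 c)) → a i ⬝ᵥ s + t * y i < 1)
    (hu : ∀ ε > (0 : ℝ), ∃ u ∈ integerPoints n,
      (∀ j, (∃ c, Tendsto (fun k => (fun l => (A j l : ℝ)) ⬝ᵥ σ k) atTop (𝓝 c)) →
        (fun l => (A j l : ℝ)) ⬝ᵥ u = 0) ∧
      ∀ i, (∃ c, Tendsto (fun k => a i ⬝ᵥ σ k) atTop (𝓝 c)) → |a i ⬝ᵥ u - t * y i| < ε) :
    False := by
  subst hQ hS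
  obtain ⟨ε, hε, hεpos⟩ : ∃ ε : ℝ, (∀ i, (∃ c, Tendsto (fun k => a i ⬝ᵥ σ k) atTop (𝓝 c)) →
      a i ⬝ᵥ s + t * y i + 2 * ε < 1) ∧ 0 < ε := by
    have hev : ∀ᶠ ε in 𝓝[>] (0 : ℝ), ∀ i,
        (∃ c, Tendsto (fun k => a i ⬝ᵥ σ k) atTop (𝓝 c)) → a i ⬝ᵥ s + t * y i + 2 * ε < 1 := by
      refine eventually_all.2 fun i => ?_
      by_cases hi : ∃ c, Tendsto (fun k => a i ⬝ᵥ σ k) atTop (𝓝 c)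
      · have hcont : Continuous fun ε : ℝ => a i ⬝ᵥ s + t * y i + 2 * ε := by fun_prop
        have hlt : ∀ᶠ ε in 𝓝 (0 : ℝ), a i ⬝ᵥ s + t * y i + 2 * ε < 1 :=
          hcont.continuousAt.eventually_lt continuousAt_const (by simpa using hst i hi)
        exact (hlt.filter_mono nhdsWithin_le_nhds).mono fun ε h _ => h
      · exact Eventually.of_forall fun _ h => absurd h hi
    exact (hev.and self_mem_nhdsWithin).exists
  obtain ⟨u, huint, huA, hua⟩ := hu ε hεpos
  have hevA : ∀ᶠ N in atTop, ∀ j,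
      (∃ c, Tendsto (fun k => (fun l => (A j l : ℝ)) ⬝ᵥ σ k) atTop (𝓝 c)) →
      ∀ k ≥ N, (fun l => (A j l : ℝ)) ⬝ᵥ (σ k - σ N) = 0 := by
    refine eventually_all.2 fun j => ?_
    by_cases hj : ∃ c, Tendsto (fun k => (fun l => (A j l : ℝ)) ⬝ᵥ σ k) atTop (𝓝 c)
    · filter_upwards [eventually_forall_ge_dotProduct_sub_eq_zero (A j) (fun k => (hσ k).1) hj]
        with N hN _ k hk using hN N le_rfl k hk
    · exact Eventually.of_forall fun _ h => absurd h hj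
  have heva : ∀ᶠ N in atTop, ∀ i, (∃ c, Tendsto (fun k => a i ⬝ᵥ σ k) atTop (𝓝 c)) →
      ∀ k ≥ N, |a i ⬝ᵥ σ k - a i ⬝ᵥ σ N| < ε := by
    refine eventually_all.2 fun i => ?_
    by_cases hi : ∃ c, Tendsto (fun k => a i ⬝ᵥ σ k) atTop (𝓝 c)
    · obtain ⟨c, hc⟩ := hi
      filter_upwards [hc.eventually_forall_ge_abs_sub_lt hεpos] with N hN _ k hk
        using hN N le_rfl k hk
    · exact Eventually.of_forall fun _ h => absurd h hi
  obtain ⟨N, hNA, hNa⟩ := (hevA.and heva).exists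
  -- with `N` fixed, the coordinates that tend to `-∞` are pushed below any bound
  have hevA' : ∀ᶠ k in atTop, ∀ j, Tendsto (fun k => (fun l => (A j l : ℝ)) ⬝ᵥ σ k) atTop atBot →
      (fun l => (A j l : ℝ)) ⬝ᵥ (s + u + (σ k - σ N)) ≤ (β j : ℝ) := by
    refine eventually_all.2 fun j => ?_
    by_cases hj : Tendsto (fun k => (fun l => (A j l : ℝ)) ⬝ᵥ σ k) atTop atBot
    · filter_upwards [hj.eventually_le_atBot
        ((β j : ℝ) - (fun l => (A j l : ℝ)) ⬝ᵥ (s + u) + (fun l => (A j l : ℝ)) ⬝ᵥ σ N)]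
        with k hk _
      rw [dotProduct_add, dotProduct_sub]
      linarith
    · exact Eventually.of_forall fun _ h => absurd h hj
  have heva' : ∀ᶠ k in atTop, ∀ i, Tendsto (fun k => a i ⬝ᵥ σ k) atTop atBot →
      a i ⬝ᵥ (s + u + (σ k - σ N)) < 1 := by
    refine eventually_all.2 fun i => ?_
    by_cases hi : Tendsto (fun k => a i ⬝ᵥ σ k) atTop atBot
    · filter_upwards [hi.eventually_lt_atBot (1 - a i ⬝ᵥ (s + u) + a i ⬝ᵥ σ N)] with k hk _
      rw [dotProduct_add, dotProduct_sub]
      linarith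
    · exact Eventually.of_forall fun _ h => absurd h hi
  obtain ⟨k, hkA, hka, hNk⟩ := (hevA'.and (heva'.and (eventually_ge_atTop N))).exists
  obtain ⟨i, hi⟩ := hint (s + u + (σ k - σ N)) ⟨add_mem_translatedLattice
      (add_mem_translatedLattice hs.1 huint) (sub_mem_integerPoints (hσ k).1 (hσ N).1), fun j => by
    rcases hA j with hj | hj
    · exact hkA j hj
    · rw [dotProduct_add, dotProduct_add, huA j hj, hNA j hj k hNk]
      linarith [hs.2 j]⟩
  rcases ha i with h | h
  · exact (hka i h).not_ge hi
  · rw [dotProduct_add, dotProduct_add, dotProduct_sub] at hi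
    linarith [hε i h, (abs_lt.1 (hua i h)).2, (abs_lt.1 (hNa i h k hNk)).2]

/-- Modulo the equality space, there are only finitely many points in `K ∩ S`, because they have
finitely many vectors of values `(a i ⬝ᵥ s)`. A sequence with distinct vectors would, after
relaxing `K` along the direction in which these vectors tend to `-∞` or accumulate, contradict
maximality. -/
theorem finite_image_dotProduct {n : ℕ} {b : Fin n → ℝ} {Q S K : Set (Fin n → ℝ)}
    (hQ : IsRationalPolyhedron Q) (hS : S = translatedLattice b ∩ Q)
    {I : Type*} [Finite I] {a : I → Fin n → ℝ}
    (hKa : IsIrredundantDescription a K) (hK : IsMaximalSFree S K) :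
    ((fun s i => a i ⬝ᵥ s) '' (K ∩ S)).Finite := by
  by_contra hinf
  obtain ⟨m, A, β, hQ⟩ := hQ
  let e := Set.Infinite.natEmbedding _ hinf
  choose σ₀ hσ₀ hσ₀e using fun k => (e k).2
  obtain ⟨φ, hφ, hlim⟩ := exists_subseq_tendsto_atBot_or_nhds
    (fun k => Sum.elim (fun i => a i ⬝ᵥ σ₀ k) fun j => (fun l => (A j l : ℝ)) ⬝ᵥ σ₀ k)
    (Sum.elim (fun _ => 1) fun j => (β j : ℝ)) (by
      rintro k (i | j)
      · have h := (hσ₀ k).1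
        rw [hKa.eq_setOf] at h
        exact h i
      · have h := (hσ₀ k).2
        rw [hS, hQ] at h
        exact h.2 j)
  have ha := fun i => hlim (.inl i)
  have hA := fun j => hlim (.inr j)
  simp only [Sum.elim_inl] at ha
  simp only [Sum.elim_inr] at hA
  set σ : ℕ → Fin n → ℝ := fun k => σ₀ (φ k) with hσdef
  have hσ : ∀ k, σ k ∈ S := fun k => (hσ₀ _).2
  have hσL : ∀ k, σ k ∈ translatedLattice b := fun k => (hS ▸ hσ k).1
  have hinj : Function.Injective fun k i => a i ⬝ᵥ σ k := by
    intro k l hkl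
    refine hφ.injective (e.injective (Subtype.ext ?_))
    rw [← hσ₀e, ← hσ₀e]
    exact hkl
  have hint : ∀ s ∈ S, ∃ i, 1 ≤ a i ⬝ᵥ s := by
    intro s hs
    by_contra! h
    refine eq_empty_iff_forall_notMem.1 hK.1.interior_inter s ⟨?_, hs⟩
    rw [hKa.eq_setOf, interior_setOf_forall_dotProduct_le_one]
    exact h
  set C : Set I := {i | ∃ c, Tendsto (fun k => a i ⬝ᵥ σ k) atTop (𝓝 c)} with hC
  by_cases hall : ∀ i, i ∈ C
  -- all the coordinates converge: relax along a tangent direction of the sequence of values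
  · obtain ⟨y, hy, happ⟩ := exists_direction_of_tendsto hinj hall
    obtain ⟨i₀, hi₀⟩ := hy
    obtain ⟨s, hs, t, hst⟩ := hK.exists_mem_relaxation hKa C y ⟨i₀, Or.inr hi₀⟩
    refine false_of_sequence hQ hS hint hσ ha hA y hs t hst fun ε hε => ?_
    have hev : ∀ᶠ M in atTop, ∀ j,
        (∃ c, Tendsto (fun k => (fun l => (A j l : ℝ)) ⬝ᵥ σ k) atTop (𝓝 c)) →
        ∀ l ≥ M, ∀ k ≥ M, (fun l => (A j l : ℝ)) ⬝ᵥ (σ k - σ l) = 0 := by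
      refine eventually_all.2 fun j => ?_
      by_cases hj : ∃ c, Tendsto (fun k => (fun l => (A j l : ℝ)) ⬝ᵥ σ k) atTop (𝓝 c)
      · exact (eventually_forall_ge_dotProduct_sub_eq_zero (A j) hσL hj).mono fun _ h _ => h
      · exact Eventually.of_forall fun _ h => absurd h hj
    obtain ⟨M, hM⟩ := hev.exists
    obtain ⟨l, hl, N, hN⟩ := happ t ε hε M
    refine ⟨(N : ℝ) • (σ (l + 1) - σ l),
      integerPoints_intCast_smul N (sub_mem_integerPoints (hσL _) (hσL _)), fun j hj => ?_,
      fun i _ => ?_⟩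
    · rw [dotProduct_smul, hM j hj l hl (l + 1) (by omega), smul_zero]
    · rw [dotProduct_smul, dotProduct_sub, smul_eq_mul]
      exact hN i
  -- some coordinate tends to `-∞`: drop its inequality, no integer vector `u` is needed
  · push Not at hall
    obtain ⟨i₀, hi₀⟩ := hall
    obtain ⟨s, hs, t, hst⟩ := hK.exists_mem_relaxation hKa C 0 ⟨i₀, Or.inl hi₀⟩
    refine false_of_sequence hQ hS hint hσ ha hA 0 hs t hst fun ε hε => ⟨0, ⟨0, by simp⟩, ?_, ?_⟩
    · intros; simp
    · intros; simpa using hε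

/-! ### Spindles -/

theorem mem_recessionCone_spindle {n : ℕ} {I : Type*} {a : I → Fin n → ℝ} {k : I}
    {s : Fin n → ℝ} (hks : ∀ i, a i ⬝ᵥ s ≤ a k ⬝ᵥ s) {r : Fin n → ℝ} :
    r ∈ recessionCone (spindle a k s) ↔ r ∈ equalitySpace a := by
  constructor
  · intro h
    have h0 : (0 : Fin n → ℝ) ∈ spindle a k s := fun i => by
      simpa [sub_dotProduct] using hks i
    suffices ∀ i, a i ⬝ᵥ r = a k ⬝ᵥ r from fun i j => (this i).trans (this j).symm
    intro i
    have h1 := (h 0 h0 1 zero_le_one i).1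
    simp only [zero_add, one_smul, sub_dotProduct] at h1
    by_contra hne
    have hpos : 0 < a k ⬝ᵥ r - a i ⬝ᵥ r :=
      lt_of_le_of_ne (by linarith) fun h => hne (by linarith)
    -- along the ray of `r`, the second inequality of the spindle fails far out
    set t : ℝ := (a k ⬝ᵥ s - a i ⬝ᵥ s + 1) / (a k ⬝ᵥ r - a i ⬝ᵥ r) with ht
    have ht0 : 0 ≤ t := div_nonneg (by linarith [hks i]) hpos.le
    have h2 := (h 0 h0 t ht0 i).2
    have h3 : t * (a k ⬝ᵥ r - a i ⬝ᵥ r) = a k ⬝ᵥ s - a i ⬝ᵥ s + 1 :=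
      div_mul_cancel₀ _ hpos.ne'
    simp only [zero_add, sub_dotProduct, dotProduct_sub, dotProduct_smul, smul_eq_mul] at h2
    linarith
  · intro h x hx t _ i
    obtain ⟨h1, h2⟩ := hx i
    have h3 := h i k
    simp only [sub_dotProduct, dotProduct_sub, dotProduct_add, dotProduct_smul, smul_eq_mul,
      h3] at h1 h2 ⊢
    constructor <;> linarith

theorem recessionCone_spindle {n : ℕ} {I : Type*} {a : I → Fin n → ℝ} {k : I}
    {s : Fin n → ℝ} (hks : ∀ i, a i ⬝ᵥ s ≤ a k ⬝ᵥ s) :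
    recessionCone (spindle a k s) = equalitySpace a :=
  Set.ext fun _ => mem_recessionCone_spindle hks

theorem linealitySpace_spindle {n : ℕ} {I : Type*} {a : I → Fin n → ℝ} {k : I}
    {s : Fin n → ℝ} (hks : ∀ i, a i ⬝ᵥ s ≤ a k ⬝ᵥ s) :
    linealitySpace (spindle a k s) = equalitySpace a := by
  ext r
  rw [linealitySpace, mem_ofPred_eq, recessionCone_spindle hks]
  refine ⟨And.left, fun h => ⟨h, fun i j => ?_⟩⟩
  rw [dotProduct_neg, dotProduct_neg, h i j]

theorem spindle_congr {n : ℕ} {I : Type*} {a : I → Fin n → ℝ} {s s' : Fin n → ℝ}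
    (h : s - s' ∈ equalitySpace a) (k : I) : spindle a k s = spindle a k s' := by
  ext r
  refine forall_congr' fun i => and_congr_right fun _ => ?_
  have h := h i k
  simp only [sub_dotProduct, dotProduct_sub] at h ⊢
  constructor <;> intro _ <;> linarith

theorem spindle_subset_of_isMax {n : ℕ} {I : Type*} {a : I → Fin n → ℝ} {s : Fin n → ℝ}
    {k k' : I} (hk : ∀ i, a i ⬝ᵥ s ≤ a k ⬝ᵥ s) (hk' : ∀ i, a i ⬝ᵥ s ≤ a k' ⬝ᵥ s) :
    spindle a k s ⊆ spindle a k' s := by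
  intro r hr i
  -- the inequalities with index `k'` force `a k ⬝ᵥ r = a k' ⬝ᵥ r`
  have h1 := hr i
  have h2 := hr k'
  have h3 := hk k'
  have h4 := hk' k
  simp only [sub_dotProduct, dotProduct_sub] at h1 h2 ⊢
  constructor <;> linarith

theorem spindle_eq_of_isMax {n : ℕ} {I : Type*} {a : I → Fin n → ℝ} {s s' : Fin n → ℝ}
    (h : s - s' ∈ equalitySpace a) {k k' : I} (hk : ∀ i, a i ⬝ᵥ s ≤ a k ⬝ᵥ s)
    (hk' : ∀ i, a i ⬝ᵥ s' ≤ a k' ⬝ᵥ s') : spindle a k s = spindle a k' s' := by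
  rw [spindle_congr h k]
  have hk : ∀ i, a i ⬝ᵥ s' ≤ a k ⬝ᵥ s' := fun i => by
    have h1 := h i k
    have h2 := hk i
    simp only [dotProduct_sub] at h1
    linarith
  exact (spindle_subset_of_isMax hk hk').antisymm (spindle_subset_of_isMax hk' hk)

theorem isPolyhedron_setOf_forall {n : ℕ} {ι : Type*} [Finite ι] (A : ι → Fin n → ℝ)
    (β : ι → ℝ) : IsPolyhedron {x | ∀ i, A i ⬝ᵥ x ≤ β i} := by
  obtain ⟨m, ⟨e⟩⟩ := Finite.exists_equiv_fin ι
  refine ⟨m, fun i => A (e.symm i), fun i => β (e.symm i), ?_⟩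
  ext x
  exact ⟨fun h i => h _, fun h i => by simpa using h (e i)⟩

theorem isPolyhedron_spindle {n : ℕ} {I : Type*} [Finite I] (a : I → Fin n → ℝ) (k : I)
    (s : Fin n → ℝ) : IsPolyhedron (spindle a k s) := by
  convert isPolyhedron_setOf_forall
    (Sum.elim (fun i => a i - a k) fun i => -(a i - a k))
    (Sum.elim (fun _ => 0) fun i => -((a i - a k) ⬝ᵥ s)) using 1
  ext r
  simp only [spindle, mem_ofPred_eq, Sum.forall, Sum.elim_inl, Sum.elim_inr, forall_and,
    dotProduct_sub, neg_dotProduct, sub_nonpos, neg_le_neg_iff]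

/-- The spindle of `s` is determined by the index and the values `a i ⬝ᵥ s`. -/
theorem finite_range_spindle {n : ℕ} {I : Type*} [Finite I] {a : I → Fin n → ℝ}
    {T : Set (Fin n → ℝ)} (hT : ((fun s i => a i ⬝ᵥ s) '' T).Finite) (k : T → I) :
    (range fun s : T => spindle a (k s) (s : Fin n → ℝ)).Finite := by
  refine ((finite_univ (α := I)).image2
    (fun (l : I) (v : I → ℝ) => {r | ∀ i, (a i - a l) ⬝ᵥ r ≤ 0 ∧
      v i - v l - (a i - a l) ⬝ᵥ r ≤ 0}) hT).subset ?_
  rintro _ ⟨s, rfl⟩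
  refine ⟨k s, mem_univ _, _, ⟨s, s.2, rfl⟩, ?_⟩
  simp only [spindle, dotProduct_sub, sub_dotProduct]

/-! ### The lifting region -/

theorem mainTheorem11 {n : ℕ} (b : Fin n → ℝ) (hb : b ∉ integerPoints n)
    (Q : Set (Fin n → ℝ)) (hQ : IsRationalPolyhedron Q)
    (S : Set (Fin n → ℝ)) (hS : S = translatedLattice b ∩ Q)
    {I : Type*} [Finite I] (a : I → Fin n → ℝ) (K : Set (Fin n → ℝ))
    (hKa : IsIrredundantDescription a K) (h0 : 0 ∈ interior K)
    (hK : IsMaximalSFree S K) :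
    -- every point of `K ∩ S` has an index `k(s)`, so that its spindle is defined
    (∀ s ∈ K ∩ S, ∃ i, a i ⬝ᵥ s = 1) ∧
    -- for every choice of the indices `k(s)`, `s ∈ K ∩ S`, the three facts hold
    (∀ k : ↥(K ∩ S) → I, (∀ s, a (k s) ⬝ᵥ (s : Fin n → ℝ) = 1) →
      (∀ s : ↥(K ∩ S),
        linealitySpace (spindle a (k s) (s : Fin n → ℝ)) = equalitySpace a ∧
        recessionCone (spindle a (k s) (s : Fin n → ℝ)) = equalitySpace a) ∧
      (∀ s s' : ↥(K ∩ S), (s : Fin n → ℝ) - (s' : Fin n → ℝ) ∈ equalitySpace a →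
        spindle a (k s) (s : Fin n → ℝ) = spindle a (k s') (s' : Fin n → ℝ)) ∧
      (∃ F : Set (Set (Fin n → ℝ)), F.Finite ∧ (∀ P ∈ F, IsPolyhedron P) ∧
        liftingRegion a S K k = ⋃₀ F)) ∧
    -- the second fact for arbitrary points: with a common index, and with any maximizing indices
    (∀ s s' : Fin n → ℝ, s - s' ∈ equalitySpace a →
      (∀ i, spindle a i s = spindle a i s') ∧
      (∀ i i', (∀ j, a j ⬝ᵥ s ≤ a i ⬝ᵥ s) → (∀ j, a j ⬝ᵥ s' ≤ a i' ⬝ᵥ s') →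
        spindle a i s = spindle a i' s')) := by
  have hone : ∀ s ∈ K ∩ S, ∀ i, a i ⬝ᵥ s ≤ 1 := fun s hs => by
    have h := hs.1
    rw [hKa.eq_setOf] at h
    exact h
  refine ⟨fun s hs => ?_, fun k hk => ?_, fun s s' h => ⟨spindle_congr h, fun i i' =>
    spindle_eq_of_isMax h⟩⟩
  · by_contra! h
    refine eq_empty_iff_forall_notMem.1 hK.1.interior_inter s ⟨?_, hs.2⟩
    rw [hKa.eq_setOf, interior_setOf_forall_dotProduct_le_one]
    exact fun i => lt_of_le_of_ne (hone s hs i) (h i)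
  · have hmax : ∀ s : ↥(K ∩ S), ∀ i, a i ⬝ᵥ (s : Fin n → ℝ) ≤ a (k s) ⬝ᵥ (s : Fin n → ℝ) :=
      fun s i => (hone s s.2 i).trans (hk s).ge
    refine ⟨fun s => ⟨linealitySpace_spindle (hmax s), recessionCone_spindle (hmax s)⟩,
      fun s s' h => spindle_eq_of_isMax h (hmax s) (hmax s'),
      range fun s : ↥(K ∩ S) => spindle a (k s) (s : Fin n → ℝ),
      finite_range_spindle (finite_image_dotProduct hQ hS hKa hK) k, ?_, ?_⟩
    · rintro _ ⟨s, rfl⟩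
      exact isPolyhedron_spindle _ _ _
    · rw [liftingRegion, sUnion_range]
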